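/- Let $\Bbbk$ be a field of characteristic zero and let $\mathscr P=\{\mathscr P(n)\}_{n\ge 1}$ be a $\Bbbk$-linear cyclic operad (for instance a cyclic Koszul operad with $\mathscr P(1)=\Bbbk$): a symmetric operad with unit $1\in\mathscr P(1)$ and partial compositions $\circ_i$, in which the $\mathbb S_n$-action on $\mathscr P(n)$ (where $\sigma$ turns the input $a$ of $p$ into the input $\sigma(a)$ of $\sigma p$) is extended to an action of $\mathbb S_{n+1}$, the permutations of $\{0,1,\dots,n\}$ ($0$ stands for the output), such that $1^*=1$ and $(p\circ_i q)^*=q^*\circ_1 p^*$ for $p\in\mathscr P(i)$, $q\in\mathscr P(j)$, where $p^*=\tau p$ and $\tau$ is the cycle $0\mapsto 1\mapsto\dots\mapsto n\mapsto 0$. Let $(E,\omega)$ be a finite-dimensional symplectic $\Bbbk$-vector space and let $A=T_{\mathscr P}E$ be the free $\mathscr P$-algebra on $E$. Put $$\mathsf R(A)=\bigoplus_{i\ge1}\mathsf R^i(A),\qquad \mathsf R^i(A)=\mathscr P(i)\otimes_{\mathbb S_{i+1}}E^{\otimes(i+1)},$$ the coinvariants of the diagonal action on $\mathscr P(i)\otimes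 E^{\otimes(i+1)}$, where $\sigma(u_0\otimes\dots\otimes u_i)=u_{\sigma^{-1}(0)}\otimes\dots\otimes u_{\sigma^{-1}(i)}$. For $\mu\in\mathscr P(i)$, $\nu\in\mathscr P(j)$ let $\mu\star\nu=\mu(1,\dots,1,\nu)\in\mathscr P(i+j-1)$, and let $G$ be the bilinear map $$G(\mu\otimes u_0\otimes\dots\otimes u_i,\ \nu\otimes v_0\otimes\dots\otimes v_j)=\omega(u_i,v_0)\,\bigl[(\mu\star\nu)\otimes u_0\otimes\dots\otimes u_{i-1}\otimes v_1\otimes\dots\otimes v_j\bigr]\in\mathsf R^{i+j-1}(A).$$ Let $\{-,-\}_\omega$ be the bilinear map on $\mathsf R(A)$ whose components $\mathsf R^i(A)\times\mathsf R^j(A)\to\mathsf R^{i+j-1}(A)$ are $$\{[x],[y]\}_\omega=\frac1{i!\,j!}\sum_{\sigma\in\mathbb S_{i+1}}\ \sum_{\rho\in\mathbb S_{j+1}}G(\sigma x,\rho y).$$ Then (1) $\{[x],[y]\}_\omega=\sum_{a=0}^{i}\sum_{b=0}^{j}G(\tau^a x,\tau^b y)$ for all $x\in\mathscr P(i)\otimes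 E^{\otimes(i+1)}$ and $y\in\mathscr P(j)\otimes E^{\otimes(j+1)}$, where $\tau$ denotes the cycle $0\mapsto1\mapsto\dots\mapsto 0$ in $\mathbb S_{i+1}$ and in $\mathbb S_{j+1}$, respectively; (2) the bracket $\{-,-\}_\omega$ makes $\mathsf R^{\bullet-1}(A)$, i.e. $\mathsf R(A)$ with $\mathsf R^i(A)$ placed in degree $i-1$, into a graded Lie algebra: it is alternating, satisfies the Jacobi identity (both in the ordinary sense, without signs), and is additive on degrees. -/

import Mathlib

open scoped TensorProduct DirectSum

universe u v w

/-! ### Operads and cyclic operads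

All spaces are indexed by `m = arity - 1`: an operad `𝒫 = {𝒫(n), n = 1, 2, …}` is given by the
family `P : ℕ → Type v` with `P m = 𝒫(m + 1)`.  So `P 0` is the space of operations of arity one,
the inputs of an element of `P m` are numbered by `Fin (m + 1)`, and a partial composition
`∘ᵢ` maps `P m ⊗ P n` to `P (m + n)`.  Compositions carry an equation `m + n = l` and take
values in `P l`, which avoids transporting elements along equalities of arities. -/

/-- The input of `p ∘ᵢ q` (`p` with `m + 1` inputs, `q` with `n + 1` inputs) which comes from the
input `a ≠ i` of `p`: the input `a` keeps its number if `a < i` and is shifted by `n` if `a > i`. -/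
def outerPos {m n l : ℕ} (h : m + n = l) (i a : Fin (m + 1)) : Fin (l + 1) :=
  if a < i then ⟨a, by omega⟩ else ⟨a + n, by omega⟩

/-- The input of `p ∘ᵢ q` which comes from the input `b` of `q`. -/
def innerPos {m n l : ℕ} (h : m + n = l) (i : Fin (m + 1)) (b : Fin (n + 1)) : Fin (l + 1) :=
  ⟨i + b, by omega⟩

/-- The structure of a `k`-linear (symmetric, unital) operad `{𝒫(n), n ≥ 1}` on the family
`P m = 𝒫(m + 1)`, through partial compositions. -/
structure OperadStr (k : Type u) [Field k] (P : ℕ → Type v)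
    [∀ m, AddCommGroup (P m)] [∀ m, Module k (P m)] where
  /-- The (left) action of the symmetric group on `m + 1` letters on `𝒫(m + 1)`:
  the input `a` of `p` becomes the input `σ a` of `σ • p`. -/
  act : ∀ m : ℕ, Representation k (Equiv.Perm (Fin (m + 1))) (P m)
  /-- The unit in `𝒫(1)`. -/
  one : P 0
  /-- The partial composition `p ∘ᵢ q`: the output of `q` is inserted in the input `i` of `p`. -/
  comp : ∀ {m n l : ℕ}, m + n = l → Fin (m + 1) → P m →ₗ[k] P n →ₗ[k] P l
  one_comp : ∀ {n : ℕ} (q : P n), comp (Nat.zero_add n) 0 one q = q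
  comp_one : ∀ {m : ℕ} (i : Fin (m + 1)) (p : P m), comp (Nat.add_zero m) i p one = p
  /-- Sequential associativity `(p ∘ᵢ q) ∘ r = p ∘ᵢ (q ∘ⱼ r)`. -/
  assoc_seq : ∀ {m n l mn nl s : ℕ} (h₁ : m + n = mn) (h₂ : mn + l = s) (h₃ : n + l = nl)
    (h₄ : m + nl = s) (i : Fin (m + 1)) (j : Fin (n + 1)) (p : P m) (q : P n) (r : P l),
    comp h₂ (innerPos h₁ i j) (comp h₁ i p q) r = comp h₄ i p (comp h₃ j q r)
  /-- Parallel associativity: insertions of `q` and `r` in two different inputs `i < j` of `p`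
  commute. -/
  assoc_par : ∀ {m n l mn ml s : ℕ} (h₁ : m + n = mn) (h₂ : mn + l = s) (h₃ : m + l = ml)
    (h₄ : ml + n = s) (i j : Fin (m + 1)), i < j → ∀ (p : P m) (q : P n) (r : P l),
    comp h₂ (outerPos h₁ i j) (comp h₁ i p q) r = comp h₄ (outerPos h₃ j i) (comp h₃ j p r) q
  /-- Equivariance: `(σ • p) ∘_{σ i} (τ • q) = π • (p ∘ᵢ q)`, where `π` is the block permutation
  which acts on the inputs that come from `p` as `σ` and on those that come from `q` as `τ`. -/
  equivariant : ∀ {m n l : ℕ} (h : m + n = l) (i : Fin (m + 1)) (σ : Equiv.Perm (Fin (m + 1)))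
    (τ : Equiv.Perm (Fin (n + 1))) (π : Equiv.Perm (Fin (l + 1))),
    (∀ a, a ≠ i → π (outerPos h i a) = outerPos h (σ i) (σ a)) →
    (∀ b, π (innerPos h i b) = innerPos h (σ i) (τ b)) →
    ∀ (p : P m) (q : P n), comp h (σ i) (act m σ p) (act n τ q) = act l π (comp h i p q)

/-- The structure of a cyclic operad (Getzler–Kapranov) on the family `P m = 𝒫(m + 1)`: an operad
together with an extension of the action of `𝕊_{m+1}` on `𝒫(m + 1)` to an action of `𝕊_{m+2}`.
The label `0 : Fin (m + 2)` stands for the output of an operation and the label `a.succ` for its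
input `a`.  With `τ` the cycle `0 ↦ 1 ↦ 2 ↦ ⋯ ↦ 0` and `p* = τ • p`, the axioms are `1* = 1`
and `(p ∘_last q)* = q* ∘_first p*`. -/
structure CyclicOperadStr (k : Type u) [Field k] (P : ℕ → Type v)
    [∀ m, AddCommGroup (P m)] [∀ m, Module k (P m)] extends OperadStr k P where
  cyc : ∀ m : ℕ, Representation k (Equiv.Perm (Fin (m + 2))) (P m)
  cyc_extends : ∀ {m : ℕ} (σ : Equiv.Perm (Fin (m + 1))) (π : Equiv.Perm (Fin (m + 2))),
    π 0 = 0 → (∀ a : Fin (m + 1), π a.succ = (σ a).succ) → cyc m π = act m σ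
  cyc_one : cyc 0 (finRotate 2) one = one
  cyc_comp : ∀ {m n l : ℕ} (h : m + n = l) (h' : n + m = l) (p : P m) (q : P n),
    cyc l (finRotate (l + 2)) (comp h (Fin.last m) p q)
      = comp h' 0 (cyc n (finRotate (n + 2)) q) (cyc m (finRotate (m + 2)) p)

/-! ### The space `R(A)` for the free algebra `A` on a vector space `E` -/

noncomputable section

/-- The action of the symmetric group on `E^{⊗ n}` by permutation of the tensor factors. -/
def tensorPerm (k : Type u) [Field k] (E : Type w) [AddCommGroup E] [Module k E] (n : ℕ) :
    Representation k (Equiv.Perm (Fin n)) (⨂[k] _ : Fin n, E) where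
  toFun σ := (PiTensorProduct.reindex k (fun _ : Fin n => E) σ).toLinearMap
  map_one' := by
    ext f
    exact PiTensorProduct.reindex_tprod (1 : Equiv.Perm (Fin n)) f
  map_mul' σ τ := by
    refine PiTensorProduct.ext (MultilinearMap.ext fun f => ?_)
    simp only [LinearMap.compMultilinearMap_apply, LinearEquiv.coe_coe, Module.End.mul_apply]
    exact (PiTensorProduct.reindex_tprod (σ * τ) f).trans
      ((congrArg (PiTensorProduct.reindex k (fun _ : Fin n => E) σ)
        (PiTensorProduct.reindex_tprod τ f)).trans
          (PiTensorProduct.reindex_tprod σ (fun a => f (τ.symm a)))).symm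

theorem tensorPerm_tprod (k : Type u) [Field k] (E : Type w) [AddCommGroup E] [Module k E] (n : ℕ)
    (σ : Equiv.Perm (Fin n)) (f : Fin n → E) :
    tensorPerm k E n σ (PiTensorProduct.tprod k f) = PiTensorProduct.tprod k (f ∘ σ.symm) :=
  PiTensorProduct.reindex_tprod σ f

namespace CyclicOperadStr

variable {k : Type u} [Field k] {P : ℕ → Type v} [∀ m, AddCommGroup (P m)] [∀ m, Module k (P m)]
  (𝒪 : CyclicOperadStr k P) (E : Type w) [AddCommGroup E] [Module k E]

/-- The diagonal action of `𝕊_{m+2}` on `𝒫(m + 1) ⊗ E^{⊗ (m + 2)}`. -/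
def decorated (m : ℕ) :
    Representation k (Equiv.Perm (Fin (m + 2))) (P m ⊗[k] (⨂[k] _ : Fin (m + 2), E)) :=
  (𝒪.cyc m).tprod (tensorPerm k E (m + 2))

/-- `R^{m+1}(A) = 𝒫(m + 1) ⊗_{𝕊_{m+2}} E^{⊗ (m + 2)}`, the space of coinvariants of the
diagonal action. -/
abbrev RComp (m : ℕ) : Type (max v u w) := (𝒪.decorated E m).Coinvariants

/-- `R(A) = ⨁_{i ≥ 1} 𝒫(i) ⊗_{𝕊_{i+1}} E^{⊗ (i + 1)}`, with `i = m + 1`. -/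
abbrev R : Type (max v u w) := ⨁ m : ℕ, 𝒪.RComp E m

/-- The grading of `R^{• - 1}(A)`: the component of degree `m` is `R^{m+1}(A)`. -/
def grading (m : ℕ) : Submodule k (𝒪.R E) :=
  LinearMap.range (DirectSum.lof k ℕ (𝒪.RComp E) m)

end CyclicOperadStr

/-! ### The bracket -/

/-- The family `u₀, …, u_m, v₁, …, v_{n+1}` obtained from `u₀, …, u_{m+1}` and `v₀, …, v_{n+1}`
by omitting the last vector of the first family and the first vector of the second one.  (A label
`r ≤ m` of `p ∘_last q` is the label `r` of `p`, and a label `r > m` is the label `r - m` of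
`q`.) -/
def glueVec {E : Type w} {m n l : ℕ} (h : m + n = l) (x : Fin (m + 2) ⊕ Fin (n + 2) → E)
    (r : Fin (l + 2)) : E :=
  if hr : (r : ℕ) < m + 1 then x (Sum.inl ⟨r, by omega⟩)
  else x (Sum.inr ⟨r - m, by omega⟩)

theorem glueVec_update_last {E : Type w} {m n l : ℕ} (h : m + n = l)
    [DecidableEq (Fin (m + 2) ⊕ Fin (n + 2))] (x : Fin (m + 2) ⊕ Fin (n + 2) → E) (e : E) :
    glueVec h (Function.update x (Sum.inl (Fin.last (m + 1))) e) = glueVec h x := by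
  funext r
  unfold glueVec
  split_ifs with hr
  · rw [Function.update_of_ne]
    intro hc
    have := congrArg Fin.val (Sum.inl.inj hc)
    simp at this
    omega
  · rw [Function.update_of_ne]
    simp

theorem glueVec_update_zero {E : Type w} {m n l : ℕ} (h : m + n = l)
    [DecidableEq (Fin (m + 2) ⊕ Fin (n + 2))] (x : Fin (m + 2) ⊕ Fin (n + 2) → E) (e : E) :
    glueVec h (Function.update x (Sum.inr 0) e) = glueVec h x := by
  funext r
  unfold glueVec
  split_ifs with hr
  · rw [Function.update_of_ne]
    simp
  · rw [Function.update_of_ne]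
    intro hc
    have := congrArg Fin.val (Sum.inr.inj hc)
    simp at this
    omega

theorem exists_glueVec_update {E : Type w} {m n l : ℕ} (h : m + n = l)
    [DecidableEq (Fin (m + 2) ⊕ Fin (n + 2))] (x : Fin (m + 2) ⊕ Fin (n + 2) → E)
    (c : Fin (m + 2) ⊕ Fin (n + 2)) (h₁ : c ≠ Sum.inl (Fin.last (m + 1))) (h₂ : c ≠ Sum.inr 0) :
    ∃ s : Fin (l + 2), ∀ e : E,
      glueVec h (Function.update x c e) = Function.update (glueVec h x) s e := by
  rcases c with c | c
  · have hc : (c : ℕ) < m + 1 := by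
      by_contra hc
      exact h₁ (congrArg Sum.inl (Fin.ext (by simp; omega)))
    refine ⟨⟨c, by omega⟩, fun e => ?_⟩
    funext r
    by_cases hr : r = ⟨c, by omega⟩
    · subst hr
      simp [glueVec, hc]
    · rw [Function.update_of_ne hr]
      unfold glueVec
      split_ifs with hr'
      · rw [Function.update_of_ne]
        intro hx
        exact hr (Fin.ext (congrArg Fin.val (Sum.inl.inj hx) :))
      · rw [Function.update_of_ne]
        simp
  · have hc : 0 < (c : ℕ) := by
      by_contra hc
      exact h₂ (congrArg Sum.inr (Fin.ext (by rw [Fin.val_zero]; omega)))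
    refine ⟨⟨c + m, by omega⟩, fun e => ?_⟩
    funext r
    by_cases hr : r = ⟨c + m, by omega⟩
    · subst hr
      have : ¬ ((c : ℕ) + m < m + 1) := by omega
      simp [glueVec, this]
    · rw [Function.update_of_ne hr]
      unfold glueVec
      split_ifs with hr'
      · rw [Function.update_of_ne]
        simp
      · rw [Function.update_of_ne]
        intro hx
        refine hr (Fin.ext ?_)
        have := congrArg Fin.val (Sum.inr.inj hx)
        simp at this
        simp
        omega

/-- Contraction of the last vector of the first family with the first vector of the second one:
`(u, v) ↦ ω(u_{m+1}, v₀) u₀ ⊗ ⋯ ⊗ u_m ⊗ v₁ ⊗ ⋯ ⊗ v_{n+1}`, as a multilinear map. -/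
def contractMulti {k : Type u} [Field k] {E : Type w} [AddCommGroup E] [Module k E]
    (ω : E →ₗ[k] E →ₗ[k] k) {m n l : ℕ} (h : m + n = l) :
    MultilinearMap k (fun _ : Fin (m + 2) ⊕ Fin (n + 2) => E) (⨂[k] _ : Fin (l + 2), E) where
  toFun x := ω (x (Sum.inl (Fin.last (m + 1)))) (x (Sum.inr 0)) •
    PiTensorProduct.tprod k (glueVec h x)
  map_update_add' x c e e' := by
    by_cases h₁ : c = Sum.inl (Fin.last (m + 1))
    · subst h₁
      simp [glueVec_update_last, add_smul]
    by_cases h₂ : c = Sum.inr 0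
    · subst h₂
      simp [glueVec_update_zero, add_smul]
    obtain ⟨s, hs⟩ := exists_glueVec_update h x c h₁ h₂
    simp only [hs, Function.update_of_ne (Ne.symm h₁), Function.update_of_ne (Ne.symm h₂),
      MultilinearMap.map_update_add, smul_add]
  map_update_smul' x c t e := by
    by_cases h₁ : c = Sum.inl (Fin.last (m + 1))
    · subst h₁
      simp [glueVec_update_last, mul_smul]
    by_cases h₂ : c = Sum.inr 0
    · subst h₂
      simp [glueVec_update_zero, mul_smul]
    obtain ⟨s, hs⟩ := exists_glueVec_update h x c h₁ h₂
    simp only [hs, Function.update_of_ne (Ne.symm h₁), Function.update_of_ne (Ne.symm h₂),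
      MultilinearMap.map_update_smul]
    rw [smul_comm]

/-- The same contraction as a linear map `E^{⊗ (m + 2)} ⊗ E^{⊗ (n + 2)} → E^{⊗ (m + n + 2)}`. -/
def contract {k : Type u} [Field k] {E : Type w} [AddCommGroup E] [Module k E]
    (ω : E →ₗ[k] E →ₗ[k] k) {m n l : ℕ} (h : m + n = l) :
    (⨂[k] _ : Fin (m + 2), E) ⊗[k] (⨂[k] _ : Fin (n + 2), E) →ₗ[k] (⨂[k] _ : Fin (l + 2), E) :=
  PiTensorProduct.lift (contractMulti ω h) ∘ₗ (PiTensorProduct.tmulEquiv k E).toLinearMap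

namespace CyclicOperadStr

variable {k : Type u} [Field k] {P : ℕ → Type v} [∀ m, AddCommGroup (P m)] [∀ m, Module k (P m)]
  (𝒪 : CyclicOperadStr k P) {E : Type w} [AddCommGroup E] [Module k E]
  (ω : E →ₗ[k] E →ₗ[k] k)

/-- The operad composition `μ ⋆ ν = μ(1, …, 1, ν)`, the insertion of `ν` in the last input of
`μ`. -/
def star {m n l : ℕ} (h : m + n = l) : P m →ₗ[k] P n →ₗ[k] P l :=
  𝒪.comp h (Fin.last m)

/-- Composition, contraction with `ω` and projection to coinvariants, on
`(𝒫(m+1) ⊗ E^{⊗ (m+2)}) × (𝒫(n+1) ⊗ E^{⊗ (n+2)})`: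
`(p ⊗ u, q ⊗ v) ↦ ω(u_{m+1}, v₀) [(p ⋆ q) ⊗ u₀ ⊗ ⋯ ⊗ u_m ⊗ v₁ ⊗ ⋯ ⊗ v_{n+1}]`. -/
def glue (m n : ℕ) :
    P m ⊗[k] (⨂[k] _ : Fin (m + 2), E) →ₗ[k] P n ⊗[k] (⨂[k] _ : Fin (n + 2), E) →ₗ[k]
      𝒪.RComp E (m + n) :=
  TensorProduct.curry
    (Representation.Coinvariants.mk (𝒪.decorated E (m + n)) ∘ₗ
      TensorProduct.map (TensorProduct.lift (𝒪.star (rfl : m + n = m + n))) (contract ω rfl) ∘ₗ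
      (TensorProduct.tensorTensorTensorComm k (P m) (⨂[k] _ : Fin (m + 2), E) (P n)
        (⨂[k] _ : Fin (n + 2), E)).toLinearMap)

theorem glue_tmul_tprod (m n : ℕ) (p : P m) (q : P n) (x : Fin (m + 2) → E) (y : Fin (n + 2) → E) :
    𝒪.glue ω m n (p ⊗ₜ PiTensorProduct.tprod k x) (q ⊗ₜ PiTensorProduct.tprod k y)
      = ω (x (Fin.last (m + 1))) (y 0) •
        Representation.Coinvariants.mk (𝒪.decorated E (m + n))
          (𝒪.star rfl p q ⊗ₜ PiTensorProduct.tprod k (glueVec rfl (Sum.elim x y))) := by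
  simp [glue, contract, contractMulti, PiTensorProduct.tmulEquiv_apply, TensorProduct.tmul_smul]

/-- Symmetrisation: the class of `z` goes to `∑ σ • z`, the sum over all `σ ∈ 𝕊_{m+2}`, divided by
`(m + 1)!`, the number of those `σ` which move a given label to the last place (to the first
place).  So, inside the bracket, each label is brought to that place with total weight one. -/
def symmetrize (E : Type w) [AddCommGroup E] [Module k E] (m : ℕ) :
    𝒪.RComp E m →ₗ[k] P m ⊗[k] (⨂[k] _ : Fin (m + 2), E) :=
  ((Nat.factorial (m + 1) : k)⁻¹) •
    Representation.Coinvariants.lift (𝒪.decorated E m) (𝒪.decorated E m).norm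
      (fun σ => Representation.norm_comp_self (𝒪.decorated E m) σ)

/-- The pairing `R^{m+1}(A) × R^{n+1}(A) → R^{m+n+1}(A)`. -/
def bracketComp (m n : ℕ) : 𝒪.RComp E m →ₗ[k] 𝒪.RComp E n →ₗ[k] 𝒪.RComp E (m + n) :=
  (𝒪.glue ω m n).compl₁₂ (𝒪.symmetrize E m) (𝒪.symmetrize E n)

/-- The bracket `{-, -}_ω` on `R(A)`: the bilinear map whose components are the pairings
`bracketComp`. -/
def bracket : 𝒪.R E →ₗ[k] 𝒪.R E →ₗ[k] 𝒪.R E :=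
  DirectSum.toModule k ℕ (𝒪.R E →ₗ[k] 𝒪.R E) fun m =>
    LinearMap.flip <| DirectSum.toModule k ℕ (𝒪.RComp E m →ₗ[k] 𝒪.R E) fun n =>
      LinearMap.flip <|
        (𝒪.bracketComp ω m n).compr₂ (DirectSum.lof k ℕ (𝒪.RComp E) (m + n))

theorem bracket_lof (m n : ℕ) (x : 𝒪.RComp E m) (y : 𝒪.RComp E n) :
    𝒪.bracket ω (DirectSum.lof k ℕ (𝒪.RComp E) m x) (DirectSum.lof k ℕ (𝒪.RComp E) n y)
      = DirectSum.lof k ℕ (𝒪.RComp E) (m + n) (𝒪.bracketComp ω m n x y) := by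
  simp [bracket]

end CyclicOperadStr

/-! ### Graded Lie algebras -/

/-- The bilinear map `B` and the grading `𝒜` make `L` a graded Lie algebra: a Lie algebra (in the
ordinary sense, without signs) which is the direct sum of its homogeneous components, with
`B (𝒜 i) (𝒜 j) ⊆ 𝒜 (i + j)`. -/
structure IsGradedLieAlgebra {k : Type u} [Field k] {L : Type v} [AddCommGroup L] [Module k L]
    {ι : Type w} [AddMonoid ι] [DecidableEq ι] (𝒜 : ι → Submodule k L)
    (B : L →ₗ[k] L →ₗ[k] L) : Prop where
  isInternal : DirectSum.IsInternal 𝒜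
  mem_add : ∀ {i j : ι} {x y : L}, x ∈ 𝒜 i → y ∈ 𝒜 j → B x y ∈ 𝒜 (i + j)
  alternating : ∀ x : L, B x x = 0
  jacobi : ∀ x y z : L, B x (B y z) + B y (B z x) + B z (B x y) = 0

end

/-! Write x·y for the composition-contraction `glueT` on decorated operations, before coinvariants
are taken. The product is strictly associative (`glueT_assoc`), since the two contractions involve
disjoint pairs of labels. A permutation of x fixing its last label, or of y fixing its label 0,
passes through x·y as a permutation of the result. Hence the class of σx·ρy depends only on which
label σ brings to the last place and which label ρ brings to place 0. In the symmetrised sum each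
label occurs factorially often, the normalisation cancels this, and any transversal may replace the
symmetric group; the powers of the cycle give (1).

For invariant elements, the cyclic axiom turns x·y into y·x up to a permutation of labels, and ω
contributes a sign (`exists_glueT_swap`). This is antisymmetry. Applied twice and combined with
associativity, it gives the reversal xyz = zyx of classes (`toR_glueT_reverse`).

For Jacobi, let x, y, z be symmetrised, of arities m+1, n+1, r+1. In {x,{y,z}} the label of y·z
contracted with x is one of n+1 labels of y, each giving xyz, or one of r+1 labels of z, each giving
-xzy (`toR_glueT_sym_glueT`). So {x,{y,z}} = (n+1)xyz - (r+1)xzy, and the cyclic sum cancels by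
reversal. -/

/-! ### Sums over permutations and powers of the cycle -/

theorem sum_perm_inv_apply {V : Type*} [AddCommMonoid V] (N : ℕ) (t : Fin (N + 1))
    (φ : Fin (N + 1) → V) :
    ∑ σ : Equiv.Perm (Fin (N + 1)), φ (σ⁻¹ t) = N.factorial • ∑ c, φ c := by
  -- The substitution ρ = σ⁻¹ · (0 t) turns σ⁻¹ t into ρ 0; `decomposeFin` then splits ρ into the
  -- value ρ 0 and one of N! permutations.
  let e : Equiv.Perm (Fin (N + 1)) ≃ Equiv.Perm (Fin (N + 1)) :=
    (Equiv.inv _).trans (Equiv.mulRight (Equiv.swap 0 t))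
  rw [Fintype.sum_equiv e _ (fun ρ => φ (ρ 0)) (fun σ => by simp [e]),
    Fintype.sum_equiv Equiv.Perm.decomposeFin _ (fun pe => φ pe.1) ?_, Fintype.sum_prod_type]
  · simp [Fintype.card_perm, Finset.smul_sum]
  · intro σ
    obtain ⟨⟨p, e⟩, rfl⟩ := Equiv.Perm.decomposeFin.symm.surjective σ
    simp

/-- A sum over all permutations of a function which only depends on the label brought to the
place `t` reduces to a sum over representatives. -/
theorem sum_perm_eq_factorial_smul_sum {V : Type*} [AddCommMonoid V] (N : ℕ) (t : Fin (N + 1))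
    (f : Equiv.Perm (Fin (N + 1)) → V)
    (hf : ∀ σ σ' : Equiv.Perm (Fin (N + 1)), σ⁻¹ t = σ'⁻¹ t → f σ = f σ')
    (g : Fin (N + 1) → Equiv.Perm (Fin (N + 1)))
    (hg : Function.Bijective fun a => (g a)⁻¹ t) :
    ∑ σ, f σ = N.factorial • ∑ a, f (g a) := by
  -- The transposition of c and t serves as the standard permutation bringing c to t.
  have key : ∀ σ, f σ = (fun c => f (Equiv.swap c t)) (σ⁻¹ t) := fun σ => hf _ _ (by simp)
  rw [Finset.sum_congr rfl fun σ _ => key σ,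
    sum_perm_inv_apply N t fun c => f (Equiv.swap c t)]
  congr 1
  rw [Finset.sum_congr rfl fun a _ => key (g a)]
  exact (Fintype.sum_bijective _ hg _ _ fun _ => rfl).symm

theorem finRotate_pow_apply_add (N a : ℕ) (i : Fin (N + 1)) :
    (finRotate (N + 1) ^ a) i = i + Fin.ofNat (N + 1) a := by
  induction a with
  | zero => simp
  | succ a ih =>
    rw [pow_succ', Equiv.Perm.mul_apply, ih, finRotate_apply]
    ext
    simp [Fin.val_add, add_assoc]

theorem bijective_finRotate_pow_inv_apply (N : ℕ) (t : Fin (N + 1)) :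
    Function.Bijective fun a : Fin (N + 1) => (finRotate (N + 1) ^ (a : ℕ))⁻¹ t := by
  rw [← Finite.injective_iff_bijective]
  intro a b hab
  set c := (finRotate (N + 1) ^ (a : ℕ))⁻¹ t with hc
  have h1 : (finRotate (N + 1) ^ (a : ℕ)) c = t := by simp [hc]
  have h2 : (finRotate (N + 1) ^ (b : ℕ)) c = t := by
    have : c = (finRotate (N + 1) ^ (b : ℕ))⁻¹ t := hab
    simp [this]
  rw [finRotate_pow_apply_add] at h1 h2
  simpa using h1.trans h2.symm

/-! ### Associativity of gluing before coinvariants -/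

theorem glueVec_assoc {E : Type w} {m n r mn nr s : ℕ} (h₁ : m + n = mn) (h₂ : mn + r = s) (h₃ : n + r = nr)
    (h₄ : m + nr = s) (x : Fin (m + 2) → E) (y : Fin (n + 2) → E) (z : Fin (r + 2) → E) :
    glueVec h₂ (Sum.elim (glueVec h₁ (Sum.elim x y)) z)
      = glueVec h₄ (Sum.elim x (glueVec h₃ (Sum.elim y z))) := by
  funext c
  unfold glueVec
  simp only [Sum.elim_inl, Sum.elim_inr]
  split_ifs <;> first | rfl | omega | (congr 2; omega)

noncomputable section
namespace CyclicOperadStr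

variable {k : Type u} [Field k] {P : ℕ → Type v} [∀ m, AddCommGroup (P m)] [∀ m, Module k (P m)]
  (𝒪 : CyclicOperadStr k P) {E : Type w} [AddCommGroup E] [Module k E]
  (ω : E →ₗ[k] E →ₗ[k] k)

/-- Composition and contraction with `ω`, before the passage to coinvariants. -/
def glueT {m n l : ℕ} (h : m + n = l) :
    P m ⊗[k] (⨂[k] _ : Fin (m + 2), E) →ₗ[k] P n ⊗[k] (⨂[k] _ : Fin (n + 2), E) →ₗ[k]
      P l ⊗[k] (⨂[k] _ : Fin (l + 2), E) :=
  TensorProduct.curry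
    (TensorProduct.map (TensorProduct.lift (𝒪.star h)) (contract ω h) ∘ₗ
      (TensorProduct.tensorTensorTensorComm k (P m) (⨂[k] _ : Fin (m + 2), E) (P n)
        (⨂[k] _ : Fin (n + 2), E)).toLinearMap)

theorem glueT_tmul_tprod {m n l : ℕ} (h : m + n = l) (p : P m) (q : P n) (x : Fin (m + 2) → E)
    (y : Fin (n + 2) → E) :
    𝒪.glueT ω h (p ⊗ₜ PiTensorProduct.tprod k x) (q ⊗ₜ PiTensorProduct.tprod k y)
      = ω (x (Fin.last (m + 1))) (y 0) •
          (𝒪.comp h (Fin.last m) p q ⊗ₜ PiTensorProduct.tprod k (glueVec h (Sum.elim x y))) := by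
  simp [glueT, contract, contractMulti, PiTensorProduct.tmulEquiv_apply, TensorProduct.tmul_smul,
    star]

theorem glue_eq_mk_glueT (m n : ℕ) (x : P m ⊗[k] (⨂[k] _ : Fin (m + 2), E))
    (y : P n ⊗[k] (⨂[k] _ : Fin (n + 2), E)) :
    𝒪.glue ω m n x y
      = Representation.Coinvariants.mk (𝒪.decorated E (m + n)) (𝒪.glueT ω rfl x y) :=
  rfl

theorem decorated_tmul_tprod (m : ℕ) (σ : Equiv.Perm (Fin (m + 2))) (p : P m)
    (x : Fin (m + 2) → E) :
    𝒪.decorated E m σ (p ⊗ₜ PiTensorProduct.tprod k x)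
      = 𝒪.cyc m σ p ⊗ₜ PiTensorProduct.tprod k (x ∘ σ.symm) := by
  simp [decorated, tensorPerm_tprod]

theorem decorated_mul_apply (m : ℕ) (σ ρ : Equiv.Perm (Fin (m + 2)))
    (x : P m ⊗[k] (⨂[k] _ : Fin (m + 2), E)) :
    𝒪.decorated E m (σ * ρ) x = 𝒪.decorated E m σ (𝒪.decorated E m ρ x) := by
  simp

theorem tmul_tprod_induction {M : Type*} [AddCommGroup M] [Module k M] {ι : Type*}
    {C : M ⊗[k] (⨂[k] _ : ι, E) → Prop}
    (pure : ∀ p x, C (p ⊗ₜ PiTensorProduct.tprod k x))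
    (add : ∀ x y, C x → C y → C (x + y)) (x : M ⊗[k] (⨂[k] _ : ι, E)) : C x := by
  induction x using TensorProduct.induction_on with
  | zero => simpa using pure 0 0
  | add x y hx hy => exact add x y hx hy
  | tmul p t =>
    induction t using PiTensorProduct.induction_on with
    | smul_tprod r f => simpa [TensorProduct.smul_tmul] using pure (r • p) f
    | add s t hs ht => simpa [TensorProduct.tmul_add] using add _ _ hs ht

/-- Inserting always in the last input is sequential associativity. Label 0 of y·z is that of y, and
the last label of x·y is that of y, so both bracketings carry the same two scalars. -/
theorem glueT_assoc {m n r mn nr s : ℕ} (h₁ : m + n = mn) (h₂ : mn + r = s) (h₃ : n + r = nr)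
    (h₄ : m + nr = s) (x : P m ⊗[k] (⨂[k] _ : Fin (m + 2), E))
    (y : P n ⊗[k] (⨂[k] _ : Fin (n + 2), E)) (z : P r ⊗[k] (⨂[k] _ : Fin (r + 2), E)) :
    𝒪.glueT ω h₂ (𝒪.glueT ω h₁ x y) z = 𝒪.glueT ω h₄ x (𝒪.glueT ω h₃ y z) := by
  induction x using tmul_tprod_induction with
  | add x x' hx hx' => simp [hx, hx']
  | pure p x =>
  induction y using tmul_tprod_induction with
  | add x x' hx hx' => simp [hx, hx']
  | pure q y =>
  induction z using tmul_tprod_induction with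
  | add x x' hx hx' => simp [hx, hx']
  | pure t z =>
  have e1 : glueVec h₃ (Sum.elim y z) 0 = y 0 := by simp [glueVec]
  have e2 : glueVec h₁ (Sum.elim x y) (Fin.last (mn + 1)) = y (Fin.last (n + 1)) := by
    subst h₁
    have : ¬ (m + n + 1 < m + 1) := by omega
    simp only [glueVec, Fin.val_last, this, dite_false, Sum.elim_inr]
    congr 1
    ext
    simp
    omega
  have e3 : innerPos h₁ (Fin.last m) (Fin.last n) = Fin.last mn := by
    ext
    simpa [innerPos] using h₁
  have := 𝒪.assoc_seq h₁ h₂ h₃ h₄ (Fin.last m) (Fin.last n) p q t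
  rw [e3] at this
  simp [glueT_tmul_tprod, e1, e2, this, glueVec_assoc h₁ h₂ h₃ h₄, smul_smul, mul_comm]

end CyclicOperadStr
end

/-! ### Cyclic action and composition in the last input -/

/-- The permutation of `Fin (l + 1)`, `l = m + n`, which moves the initial block of `m + 1` labels
behind the block of the other `n` labels. -/
def blockRotate {m n l : ℕ} (h : m + n = l) : Equiv.Perm (Fin (l + 1)) where
  toFun a := if _ : (a : ℕ) ≤ m then ⟨a + n, by omega⟩ else ⟨a - m - 1, by omega⟩
  invFun b := if _ : (b : ℕ) < n then ⟨b + m + 1, by omega⟩ else ⟨b - n, by omega⟩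
  left_inv a := by
    by_cases h' : (a : ℕ) ≤ m
    · simp [h']
    · simp [h', show (a : ℕ) - m - 1 < n by omega]
      ext
      simp
      omega
  right_inv b := by
    by_cases h' : (b : ℕ) < n
    · simp [h', show ¬ (b : ℕ) + m + 1 ≤ m by omega]
      ext
      simp
      omega
    · simp [h', show (b : ℕ) - n ≤ m by omega]
      ext
      simp
      omega

theorem val_blockRotate {m n l : ℕ} (h : m + n = l) (a : Fin (l + 1)) :
    (blockRotate h a : ℕ) = if (a : ℕ) ≤ m then (a : ℕ) + n else a - m - 1 := by
  unfold blockRotate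
  dsimp only [Equiv.coe_fn_mk]
  split_ifs <;> rfl

theorem exists_perm_succ {N : ℕ} (π : Equiv.Perm (Fin (N + 1))) (h : π 0 = 0) :
    ∃ σ : Equiv.Perm (Fin N), ∀ a, π a.succ = (σ a).succ := by
  obtain ⟨⟨p, σ⟩, rfl⟩ := Equiv.Perm.decomposeFin.symm.surjective π
  obtain rfl : p = 0 := by simpa using h
  exact ⟨σ, fun a => by simp⟩

theorem val_finRotate (N : ℕ) (i : Fin (N + 1)) :
    (finRotate (N + 1) i : ℕ) = if (i : ℕ) = N then 0 else (i : ℕ) + 1 := by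
  rw [coe_finRotate]
  simp [Fin.ext_iff]

theorem finRotate_castSucc (N : ℕ) (a : Fin (N + 1)) : finRotate (N + 2) a.castSucc = a.succ := by
  ext
  rw [val_finRotate, Fin.val_castSucc, Fin.val_succ, if_neg (by omega)]

theorem exists_perm_extend {M N : ℕ} (ι : Fin M ↪ Fin N) (σ : Equiv.Perm (Fin M)) :
    ∃ π : Equiv.Perm (Fin N), (∀ r, π (ι r) = ι (σ r)) ∧ ∀ s, (∀ r, ι r ≠ s) → π s = s :=
  ⟨σ.viaFintypeEmbedding ι, fun r => σ.viaFintypeEmbedding_apply_image ι r, fun s hs =>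
    σ.viaFintypeEmbedding_apply_notMem_range ι (by simpa using hs)⟩

noncomputable section
namespace CyclicOperadStr

variable {k : Type u} [Field k] {P : ℕ → Type v} [∀ m, AddCommGroup (P m)] [∀ m, Module k (P m)]
  (𝒪 : CyclicOperadStr k P) {E : Type w} [AddCommGroup E] [Module k E]
  (ω : E →ₗ[k] E →ₗ[k] k)

/-- Both permutations fix the output, so this is ordinary operadic equivariance in terms of cyclic
labels. -/
theorem comp_cyc_right {m n l : ℕ} (h : m + n = l) (i : Fin (m + 1)) (ρ : Equiv.Perm (Fin (n + 2)))
    (π : Equiv.Perm (Fin (l + 2))) (hρ : ρ 0 = 0) (hπ : π 0 = 0)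
    (h₁ : ∀ a, a ≠ i → π (outerPos h i a).succ = (outerPos h i a).succ)
    (h₂ : ∀ b : Fin (n + 1), (π (innerPos h i b).succ : ℕ) = i + ρ b.succ) (p : P m) (q : P n) :
    𝒪.comp h i p (𝒪.cyc n ρ q) = 𝒪.cyc l π (𝒪.comp h i p q) := by
  obtain ⟨ρ', hρ'⟩ := exists_perm_succ ρ hρ
  obtain ⟨π', hπ'⟩ := exists_perm_succ π hπ
  rw [𝒪.cyc_extends ρ' ρ hρ hρ', 𝒪.cyc_extends π' π hπ hπ']
  have := 𝒪.equivariant h i 1 ρ' π' (fun a ha => ?_) (fun b => ?_) p q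
  · simpa using this
  · simpa [hπ'] using h₁ a ha
  · have := h₂ b
    rw [hπ', hρ'] at this
    ext
    simp [innerPos] at this ⊢
    omega

/-- Here σ may move the output, so equivariance does not apply directly. Rotating turns p ∘ q into
q* ∘ p* and the last input of p into the output of p*; the conjugate of σ then fixes label 0, and
`comp_cyc_right` applies. -/
theorem comp_last_cyc_left {m n l : ℕ} (h : m + n = l) (σ : Equiv.Perm (Fin (m + 2)))
    (π : Equiv.Perm (Fin (l + 2))) (hσ : σ (Fin.last (m + 1)) = Fin.last (m + 1))
    (h₁ : ∀ r : Fin (l + 2), m < (r : ℕ) → π r = r)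
    (h₂ : ∀ r : Fin (m + 2), (π (Fin.castLE (by omega) r) : ℕ) = σ r) (p : P m) (q : P n) :
    𝒪.comp h (Fin.last m) (𝒪.cyc m σ p) q = 𝒪.cyc l π (𝒪.comp h (Fin.last m) p q) := by
  have h' : n + m = l := by omega
  have hinj : Function.Injective (𝒪.cyc l (finRotate (l + 2))) :=
    Function.LeftInverse.injective (g := 𝒪.cyc l (finRotate (l + 2))⁻¹) fun x => by simp
  apply hinj
  have hlast : ∀ N : ℕ, finRotate (N + 2) (Fin.last (N + 1)) = 0 := fun N => finRotate_last
  have hinv : ∀ N : ℕ, (finRotate (N + 2))⁻¹ 0 = Fin.last (N + 1) := fun N => by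
    rw [Equiv.Perm.inv_eq_iff_eq, hlast]
  have e1 : 𝒪.cyc m (finRotate (m + 2)) (𝒪.cyc m σ p)
      = 𝒪.cyc m (finRotate (m + 2) * σ * (finRotate (m + 2))⁻¹)
        (𝒪.cyc m (finRotate (m + 2)) p) := by simp
  have e2 : 𝒪.cyc l (finRotate (l + 2)) (𝒪.cyc l π (𝒪.comp h (Fin.last m) p q))
      = 𝒪.cyc l (finRotate (l + 2) * π * (finRotate (l + 2))⁻¹)
        (𝒪.cyc l (finRotate (l + 2)) (𝒪.comp h (Fin.last m) p q)) := by simp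
  rw [e2, 𝒪.cyc_comp h h', 𝒪.cyc_comp h h', e1]
  have hpre : ∀ (N : ℕ) (a : Fin (N + 1)), (finRotate (N + 2))⁻¹ a.succ = a.castSucc := by
    intro N a
    rw [Equiv.Perm.inv_eq_iff_eq, finRotate_castSucc]
  apply 𝒪.comp_cyc_right h'
  · simp only [Equiv.Perm.mul_apply, hinv, hσ, hlast]
  · simp only [Equiv.Perm.mul_apply, hinv]
    rw [h₁ _ (by simp; omega), hlast]
  · intro a ha
    have ha' : (a : ℕ) ≠ 0 := fun hc => ha (Fin.ext hc)
    simp only [Equiv.Perm.mul_apply, hpre]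
    rw [h₁, finRotate_castSucc]
    rw [outerPos, if_neg (Fin.not_lt_zero a)]
    change m < (a : ℕ) + m
    omega
  · intro b
    simp only [Equiv.Perm.mul_apply, hpre, val_finRotate]
    have e3 : (innerPos h' 0 b).castSucc = Fin.castLE (by omega) b.castSucc := by
      ext
      simp [innerPos]
    have e4 : σ b.castSucc ≠ Fin.last (m + 1) := by
      rw [← hσ, σ.injective.ne_iff]
      exact (Fin.castSucc_lt_last b).ne
    have e5 : (σ b.castSucc : ℕ) < m + 1 := by
      have := Fin.val_lt_last e4
      simpa using this
    rw [e3, h₂]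
    simp
    split_ifs <;> omega

/-- The cyclic axiom gives q* ∘ p* at the first input; ρ carries that input to the last place, so
that the result is again a composition of the form ⋆. -/
theorem comp_last_swap {m n l : ℕ} (h : m + n = l) (h' : n + m = l) (ρ : Equiv.Perm (Fin (n + 2)))
    (π : Equiv.Perm (Fin (l + 2))) (hρ : ρ 0 = 0) (hπ : π 0 = 0)
    (h₁ : ∀ a, ρ a.succ = (blockRotate (Nat.zero_add n) a).succ)
    (h₂ : ∀ a, π a.succ = (blockRotate h a).succ) (p : P m) (q : P n) :
    𝒪.comp h' (Fin.last n) (𝒪.cyc n (ρ * finRotate (n + 2)) q) (𝒪.cyc m (finRotate (m + 2)) p)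
      = 𝒪.cyc l (π * finRotate (l + 2)) (𝒪.comp h (Fin.last m) p q) := by
  have e0 : blockRotate (Nat.zero_add n) 0 = Fin.last n := by
    ext
    simp [val_blockRotate]
  simp only [map_mul, Module.End.mul_apply]
  rw [𝒪.cyc_comp h h', 𝒪.cyc_extends _ ρ hρ h₁, 𝒪.cyc_extends _ π hπ h₂,
    ← 𝒪.equivariant h' 0 (blockRotate (Nat.zero_add n)) 1 (blockRotate h), e0]
  · simp
  · intro a ha
    have ha' : (a : ℕ) ≠ 0 := fun hc => ha (Fin.ext hc)
    have hlt : blockRotate (Nat.zero_add n) a < blockRotate (Nat.zero_add n) 0 := by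
      rw [Fin.lt_def, val_blockRotate, val_blockRotate]
      simp [ha']
      omega
    ext
    simp only [outerPos, hlt, if_true, Fin.not_lt_zero, if_false, val_blockRotate]
    split_ifs <;> simp_all
  · intro b
    rw [e0]
    ext
    rw [val_blockRotate, if_pos (by simpa [innerPos] using Nat.le_of_lt_succ b.2)]
    simp [innerPos]
    omega

/-! ### Equivariance and interchange for gluing -/

theorem exists_glueT_left {m n l : ℕ} (h : m + n = l) (σ : Equiv.Perm (Fin (m + 2)))
    (hσ : σ (Fin.last (m + 1)) = Fin.last (m + 1)) :
    ∃ π : Equiv.Perm (Fin (l + 2)),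
      (∀ r, π (Fin.castLE (by omega) r) = Fin.castLE (by omega) (σ r)) ∧
      ∀ (x : P m ⊗[k] (⨂[k] _ : Fin (m + 2), E)) (y : P n ⊗[k] (⨂[k] _ : Fin (n + 2), E)),
        𝒪.glueT ω h (𝒪.decorated E m σ x) y = 𝒪.decorated E l π (𝒪.glueT ω h x y) := by
  obtain ⟨π, h₁, h₂⟩ := exists_perm_extend (Fin.castLEEmb (show m + 2 ≤ l + 2 by omega)) σ
  simp only [Fin.castLEEmb_apply] at h₁ h₂
  -- The embedded block has one label too many: place m + 1 of the result belongs to y. It stays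
  -- fixed because σ fixes its last label.
  have h₃ : ∀ r : Fin (l + 2), m < (r : ℕ) → π r = r := by
    intro r hr
    by_cases hr' : (r : ℕ) = m + 1
    · have : r = Fin.castLE (by omega) (Fin.last (m + 1)) := by
        ext
        simpa using hr'
      rw [this, h₁, hσ]
    · refine h₂ r fun s hs => ?_
      have := congrArg Fin.val hs
      simp at this
      omega
  refine ⟨π, h₁, fun x y => ?_⟩
  induction x using tmul_tprod_induction with
  | add x x' hx hx' => simp [hx, hx']
  | pure p x =>
  induction y using tmul_tprod_induction with
  | add x x' hx hx' => simp [hx, hx']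
  | pure q y =>
  have hc := 𝒪.comp_last_cyc_left h σ π hσ h₃ (fun r => by rw [h₁]; rfl) p q
  have hs : σ.symm (Fin.last (m + 1)) = Fin.last (m + 1) := by rw [Equiv.symm_apply_eq, hσ]
  have hle : m + 2 ≤ l + 2 := by omega
  have hv : glueVec h (Sum.elim (x ∘ σ.symm) y) = glueVec h (Sum.elim x y) ∘ π.symm := by
    rw [Equiv.eq_comp_symm]
    funext r
    rw [Function.comp_apply]
    by_cases hr : m < (r : ℕ)
    · rw [h₃ r hr]
      simp [glueVec, show ¬ (r : ℕ) < m + 1 by omega]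
    · obtain ⟨s, hs⟩ : ∃ s : Fin (m + 2), Fin.castLE hle s = r := ⟨⟨r, by omega⟩, rfl⟩
      subst hs
      have e4 : σ s ≠ Fin.last (m + 1) := by
        rw [← hσ, σ.injective.ne_iff]
        rintro rfl
        simp at hr
      have e5 : (σ s : ℕ) < m + 1 := by simpa using Fin.val_lt_last e4
      have e6 : (s : ℕ) < m + 1 := by simpa [Nat.lt_succ_iff] using hr
      rw [h₁]
      simp [glueVec, e5, e6]
  rw [decorated_tmul_tprod, glueT_tmul_tprod, glueT_tmul_tprod, map_smul, decorated_tmul_tprod, hc,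
    hv]
  simp [hs]

theorem exists_glueT_right {m n l : ℕ} (h : m + n = l) (ρ : Equiv.Perm (Fin (n + 2)))
    (hρ : ρ 0 = 0) :
    ∃ π : Equiv.Perm (Fin (l + 2)),
      (∀ c : Fin (n + 2), π ⟨m + c, by omega⟩ = ⟨m + ρ c, by omega⟩) ∧
      ∀ (x : P m ⊗[k] (⨂[k] _ : Fin (m + 2), E)) (y : P n ⊗[k] (⨂[k] _ : Fin (n + 2), E)),
        𝒪.glueT ω h x (𝒪.decorated E n ρ y) = 𝒪.decorated E l π (𝒪.glueT ω h x y) := by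
  obtain ⟨π, h₁, h₂⟩ := exists_perm_extend
    (⟨fun c => ⟨m + c, by omega⟩, fun a b hab => by simpa [Fin.ext_iff] using hab⟩ :
      Fin (n + 2) ↪ Fin (l + 2)) ρ
  change ∀ c : Fin (n + 2), π ⟨m + c, _⟩ = ⟨m + ρ c, _⟩ at h₁
  change ∀ s, (∀ c : Fin (n + 2), (⟨m + c, _⟩ : Fin (l + 2)) ≠ s) → π s = s at h₂
  -- The overlap is now at place m, which belongs to x and is fixed because ρ 0 = 0.
  have h₃ : ∀ r : Fin (l + 2), (r : ℕ) ≤ m → π r = r := by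
    intro r hr
    by_cases hr' : (r : ℕ) = m
    · have : r = ⟨m + (0 : Fin (n + 2)), by omega⟩ := by
        ext
        simpa using hr'
      rw [this, h₁, hρ]
    · refine h₂ r fun s hs => ?_
      have := congrArg Fin.val hs
      simp at this
      omega
  have h₄ : ∀ c, c ≠ 0 → ρ c ≠ 0 := fun c hc => by rwa [← hρ, ρ.injective.ne_iff]
  refine ⟨π, h₁, fun x y => ?_⟩
  induction x using tmul_tprod_induction with
  | add x x' hx hx' => simp [hx, hx']
  | pure p x =>
  induction y using tmul_tprod_induction with
  | add x x' hx hx' => simp [hx, hx']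
  | pure q y =>
  have hc : 𝒪.comp h (Fin.last m) p (𝒪.cyc n ρ q) = 𝒪.cyc l π (𝒪.comp h (Fin.last m) p q) := by
    apply 𝒪.comp_cyc_right h (Fin.last m) ρ π hρ (h₃ 0 (by simp))
    · intro a ha
      have := Fin.val_lt_last ha
      apply h₃
      simp [outerPos, Fin.lt_last_iff_ne_last.2 ha]
      simpa using this
    · intro b
      have : (innerPos h (Fin.last m) b).succ = ⟨m + b.succ, by simp; omega⟩ := by
        ext
        simp [innerPos]
        omega
      rw [this, h₁]
      simp
  have hs : ρ.symm 0 = 0 := by rw [Equiv.symm_apply_eq, hρ]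
  have hlt : ∀ s : Fin (n + 2), m + (s : ℕ) < l + 2 := fun s => by omega
  have hv : glueVec h (Sum.elim x (y ∘ ρ.symm)) = glueVec h (Sum.elim x y) ∘ π.symm := by
    rw [Equiv.eq_comp_symm]
    funext r
    rw [Function.comp_apply]
    by_cases hr : (r : ℕ) ≤ m
    · rw [h₃ r hr]
      simp [glueVec, show (r : ℕ) < m + 1 by omega]
    · obtain ⟨s, hs⟩ : ∃ s : Fin (n + 2), ⟨m + s, hlt s⟩ = r :=
        ⟨⟨r - m, by omega⟩, Fin.ext (by simp; omega)⟩
      subst hs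
      have e5 : ρ s ≠ 0 := h₄ s (by rintro rfl; simp at hr)
      have e6 : (s : ℕ) ≠ 0 := fun hc => hr (by simp [hc])
      have e7 : (ρ s : ℕ) ≠ 0 := fun hc => e5 (Fin.ext hc)
      rw [h₁]
      simp [glueVec, show ¬ m + (s : ℕ) < m + 1 by omega, show ¬ m + (ρ s : ℕ) < m + 1 by omega]
  rw [decorated_tmul_tprod, glueT_tmul_tprod, glueT_tmul_tprod, map_smul, decorated_tmul_tprod, hc,
    hv]
  simp [hs]

theorem exists_glueT_swap (hω : ω.IsAlt) {m n l : ℕ} (h : m + n = l) (h' : n + m = l) :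
    ∃ (α : Equiv.Perm (Fin (n + 2))) (β : Equiv.Perm (Fin (m + 2)))
      (π : Equiv.Perm (Fin (l + 2))),
      α (Fin.last (n + 1)) = 0 ∧ β (Fin.last (m + 1)) = 0 ∧ π (Fin.last (l + 1)) = 0 ∧
      ∀ (x : P m ⊗[k] (⨂[k] _ : Fin (m + 2), E)) (y : P n ⊗[k] (⨂[k] _ : Fin (n + 2), E)),
        𝒪.glueT ω h' (𝒪.decorated E n α y) (𝒪.decorated E m β x)
          = -𝒪.decorated E l π (𝒪.glueT ω h x y) := by
  set ρ : Equiv.Perm (Fin (n + 2)) :=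
    Equiv.Perm.decomposeFin.symm (0, blockRotate (Nat.zero_add n)) with hρ
  set θ : Equiv.Perm (Fin (l + 2)) := Equiv.Perm.decomposeFin.symm (0, blockRotate h) with hθ
  have r0 : ρ 0 = 0 := by simp [hρ]
  have t0 : θ 0 = 0 := by simp [hθ]
  have r1 : ∀ a, ρ a.succ = (blockRotate (Nat.zero_add n) a).succ := fun a => by simp [hρ]
  have t1 : ∀ a, θ a.succ = (blockRotate h a).succ := fun a => by simp [hθ]
  have hlast : ∀ N : ℕ, finRotate (N + 2) (Fin.last (N + 1)) = 0 := fun N => finRotate_last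
  have α0 : (ρ * finRotate (n + 2)) (Fin.last (n + 1)) = 0 := by simp [hlast, r0]
  have π0 : (θ * finRotate (l + 2)) (Fin.last (l + 1)) = 0 := by simp [hlast, t0]
  refine ⟨ρ * finRotate (n + 2), finRotate (m + 2), θ * finRotate (l + 2), α0, hlast m, π0,
    fun x y => ?_⟩
  induction x using tmul_tprod_induction with
  | add x x' hx hx' => simp only [map_add, LinearMap.add_apply, hx, hx', neg_add]
  | pure p x =>
  induction y using tmul_tprod_induction with
  | add x x' hx hx' => simp only [map_add, LinearMap.add_apply, hx, hx', neg_add]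
  | pure q y =>
  have hc := 𝒪.comp_last_swap h h' ρ θ r0 t0 r1 t1 p q
  -- The permutation ρτ is the transposition of 0 and the last label. The contracted vectors are
  -- therefore the same as before, in opposite order, whence the sign.
  have α1 : (ρ * finRotate (n + 2)).symm (Fin.last (n + 1)) = 0 := by
    rw [Equiv.symm_apply_eq, Equiv.Perm.mul_apply, ← Fin.castSucc_zero, finRotate_castSucc, r1]
    ext
    simp [val_blockRotate]
  have β1 : (finRotate (m + 2)).symm 0 = Fin.last (m + 1) := by
    rw [Equiv.symm_apply_eq, hlast]
  have hv : glueVec h' (Sum.elim (y ∘ (ρ * finRotate (n + 2)).symm) (x ∘ (finRotate (m + 2)).symm))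
      = glueVec h (Sum.elim x y) ∘ (θ * finRotate (l + 2)).symm := by
    rw [Equiv.eq_comp_symm]
    funext r
    rw [Function.comp_apply]
    induction r using Fin.lastCases with
    | last =>
      rw [π0]
      have e : (ρ * finRotate (n + 2)).symm 0 = Fin.last (n + 1) := by
        rw [Equiv.symm_apply_eq, α0]
      simp only [glueVec, Fin.val_zero, Nat.zero_lt_succ, Sum.elim_inl,
        Function.comp_apply, Fin.val_last, show ¬ l + 1 < m + 1 by omega, dite_false, Sum.elim_inr]
      refine (congrArg y e).trans (congrArg y (Fin.ext ?_))
      simp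
      omega
    | cast r =>
      rw [Equiv.Perm.mul_apply, finRotate_castSucc, t1]
      by_cases hr : (r : ℕ) ≤ m
      · have e : (finRotate (m + 2)).symm ⟨r + 1, by omega⟩ = ⟨r, by omega⟩ := by
          rw [Equiv.symm_apply_eq]
          exact (finRotate_castSucc m ⟨r, by omega⟩).symm
        have e' : (r : ℕ) + n + 1 - n = r + 1 := by omega
        simp [glueVec, val_blockRotate, hr, e', e]
      · have e : (ρ * finRotate (n + 2)).symm ⟨r - m, by omega⟩ = ⟨r - m, by omega⟩ := by
          rw [Equiv.symm_apply_eq, Equiv.Perm.mul_apply]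
          have : (⟨r - m, by omega⟩ : Fin (n + 2)) = Fin.castSucc ⟨r - m, by omega⟩ := rfl
          rw [this, finRotate_castSucc, r1]
          ext
          simp [val_blockRotate]
          split_ifs <;> omega
        have e' : (r : ℕ) - m - 1 + 1 = r - m := by omega
        have e'' : (r : ℕ) - m < n + 1 := by omega
        simp only [glueVec, Fin.val_succ, val_blockRotate, hr, if_false, e', e'', dite_true,
          Sum.elim_inl, Function.comp_apply, Fin.val_castSucc, Nat.lt_succ_iff, dite_false,
          Sum.elim_inr, e]
  rw [decorated_tmul_tprod, decorated_tmul_tprod, glueT_tmul_tprod, glueT_tmul_tprod, map_smul,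
    decorated_tmul_tprod, hc, hv, Function.comp_apply, Function.comp_apply, α1, β1, ← hω.neg,
    neg_smul]

/-! ### Passage to coinvariants and the rotation formula -/

/-- The class in `R(A)` of an element of `𝒫(m + 1) ⊗ E^{⊗ (m + 2)}`. -/
def toR (m : ℕ) : P m ⊗[k] (⨂[k] _ : Fin (m + 2), E) →ₗ[k] 𝒪.R E :=
  DirectSum.lof k ℕ (𝒪.RComp E) m ∘ₗ Representation.Coinvariants.mk (𝒪.decorated E m)

theorem toR_decorated (m : ℕ) (σ : Equiv.Perm (Fin (m + 2)))
    (x : P m ⊗[k] (⨂[k] _ : Fin (m + 2), E)) : 𝒪.toR m (𝒪.decorated E m σ x) = 𝒪.toR m x := by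
  simp only [toR, LinearMap.comp_apply]
  rw [Representation.Coinvariants.mk_self_apply]

/-- The quotient σσ'⁻¹ fixes the last label, hence passes through the gluing and disappears in the
coinvariants. -/
theorem toR_glueT_left {m n l : ℕ} (h : m + n = l) (σ σ' : Equiv.Perm (Fin (m + 2)))
    (hσ : σ⁻¹ (Fin.last (m + 1)) = σ'⁻¹ (Fin.last (m + 1)))
    (x : P m ⊗[k] (⨂[k] _ : Fin (m + 2), E)) (y : P n ⊗[k] (⨂[k] _ : Fin (n + 2), E)) :
    𝒪.toR l (𝒪.glueT ω h (𝒪.decorated E m σ x) y)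
      = 𝒪.toR l (𝒪.glueT ω h (𝒪.decorated E m σ' x) y) := by
  obtain ⟨π, -, hπ⟩ := 𝒪.exists_glueT_left (E := E) ω h (σ * σ'⁻¹) (by
    rw [Equiv.Perm.mul_apply, ← hσ]
    exact σ.apply_symm_apply _)
  rw [← 𝒪.toR_decorated l π (𝒪.glueT ω h (𝒪.decorated E m σ' x) y), ← hπ, ← decorated_mul_apply,
    inv_mul_cancel_right]

theorem toR_glueT_right {m n l : ℕ} (h : m + n = l) (ρ ρ' : Equiv.Perm (Fin (n + 2)))
    (hρ : ρ⁻¹ 0 = ρ'⁻¹ 0)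
    (x : P m ⊗[k] (⨂[k] _ : Fin (m + 2), E)) (y : P n ⊗[k] (⨂[k] _ : Fin (n + 2), E)) :
    𝒪.toR l (𝒪.glueT ω h x (𝒪.decorated E n ρ y))
      = 𝒪.toR l (𝒪.glueT ω h x (𝒪.decorated E n ρ' y)) := by
  obtain ⟨π, -, hπ⟩ := 𝒪.exists_glueT_right (E := E) ω h (ρ * ρ'⁻¹) (by
    rw [Equiv.Perm.mul_apply, ← hρ]
    exact ρ.apply_symm_apply _)
  rw [← 𝒪.toR_decorated l π (𝒪.glueT ω h x (𝒪.decorated E n ρ' y)), ← hπ, ← decorated_mul_apply,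
    inv_mul_cancel_right]

/-- The invariant element `(m + 1)!⁻¹ ∑ σ • x`. -/
def sym (m : ℕ) (x : P m ⊗[k] (⨂[k] _ : Fin (m + 2), E)) : P m ⊗[k] (⨂[k] _ : Fin (m + 2), E) :=
  ((Nat.factorial (m + 1) : k)⁻¹) • ∑ σ, 𝒪.decorated E m σ x

theorem symmetrize_mk (m : ℕ) (x : P m ⊗[k] (⨂[k] _ : Fin (m + 2), E)) :
    𝒪.symmetrize E m (Representation.Coinvariants.mk (𝒪.decorated E m) x) = 𝒪.sym m x := by
  simp [symmetrize, sym, Representation.norm]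

theorem decorated_sym (m : ℕ) (σ : Equiv.Perm (Fin (m + 2)))
    (x : P m ⊗[k] (⨂[k] _ : Fin (m + 2), E)) : 𝒪.decorated E m σ (𝒪.sym m x) = 𝒪.sym m x := by
  rw [sym, map_smul, map_sum]
  congr 1
  exact Fintype.sum_equiv (Equiv.mulLeft σ) _ _ fun ρ => by simp

theorem bracket_toR {m n l : ℕ} (h : m + n = l) (x : P m ⊗[k] (⨂[k] _ : Fin (m + 2), E))
    (y : P n ⊗[k] (⨂[k] _ : Fin (n + 2), E)) :
    𝒪.bracket ω (𝒪.toR m x) (𝒪.toR n y) = 𝒪.toR l (𝒪.glueT ω h (𝒪.sym m x) (𝒪.sym n y)) := by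
  subst h
  simp only [toR, LinearMap.comp_apply, bracket_lof, bracketComp, LinearMap.compl₁₂_apply,
    symmetrize_mk, glue_eq_mk_glueT]

/-- The transversal is left free: rotations serve for the explicit formula, transpositions (in the
right-hand version) for Jacobi. -/
theorem toR_glueT_sym_left [CharZero k] {m n l : ℕ} (h : m + n = l)
    (g : Fin (m + 2) → Equiv.Perm (Fin (m + 2)))
    (hg : Function.Bijective fun a => (g a)⁻¹ (Fin.last (m + 1)))
    (x : P m ⊗[k] (⨂[k] _ : Fin (m + 2), E)) (y : P n ⊗[k] (⨂[k] _ : Fin (n + 2), E)) :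
    𝒪.toR l (𝒪.glueT ω h (𝒪.sym m x) y)
      = ∑ a, 𝒪.toR l (𝒪.glueT ω h (𝒪.decorated E m (g a) x) y) := by
  simp only [sym, map_smul, map_sum, LinearMap.smul_apply, LinearMap.sum_apply]
  rw [sum_perm_eq_factorial_smul_sum (m + 1) (Fin.last (m + 1)) _
    (fun σ σ' hσ => 𝒪.toR_glueT_left ω h σ σ' hσ x y) g hg, ← Nat.cast_smul_eq_nsmul k,
    inv_smul_smul₀ (Nat.cast_ne_zero.2 (Nat.factorial_ne_zero _))]

theorem toR_glueT_sym_right [CharZero k] {m n l : ℕ} (h : m + n = l)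
    (g : Fin (n + 2) → Equiv.Perm (Fin (n + 2)))
    (hg : Function.Bijective fun b => (g b)⁻¹ 0)
    (x : P m ⊗[k] (⨂[k] _ : Fin (m + 2), E)) (y : P n ⊗[k] (⨂[k] _ : Fin (n + 2), E)) :
    𝒪.toR l (𝒪.glueT ω h x (𝒪.sym n y))
      = ∑ b, 𝒪.toR l (𝒪.glueT ω h x (𝒪.decorated E n (g b) y)) := by
  simp only [sym, map_smul, map_sum]
  rw [sum_perm_eq_factorial_smul_sum (n + 1) 0 _
    (fun ρ ρ' hρ => 𝒪.toR_glueT_right ω h ρ ρ' hρ x y) g hg, ← Nat.cast_smul_eq_nsmul k,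
    inv_smul_smul₀ (Nat.cast_ne_zero.2 (Nat.factorial_ne_zero _))]

theorem bracket_toR_eq_sum_rotations [CharZero k] {m n l : ℕ} (h : m + n = l)
    (x : P m ⊗[k] (⨂[k] _ : Fin (m + 2), E)) (y : P n ⊗[k] (⨂[k] _ : Fin (n + 2), E)) :
    𝒪.bracket ω (𝒪.toR m x) (𝒪.toR n y)
      = ∑ a : Fin (m + 2), ∑ b : Fin (n + 2),
          𝒪.toR l (𝒪.glueT ω h (𝒪.decorated E m (finRotate (m + 2) ^ (a : ℕ)) x)
            (𝒪.decorated E n (finRotate (n + 2) ^ (b : ℕ)) y)) := by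
  rw [𝒪.bracket_toR ω h, 𝒪.toR_glueT_sym_left ω h _ (bijective_finRotate_pow_inv_apply _ _)]
  exact Finset.sum_congr rfl fun a _ =>
    𝒪.toR_glueT_sym_right ω h _ (bijective_finRotate_pow_inv_apply _ _) _ _

/-! ### Interchange, reversal and iterated gluing of invariant elements -/

/-- Interchange of the two glued elements, up to a permutation `π` of the labels which brings the
label `0` to the last place. -/
theorem exists_glueT_swap_last (hω : ω.IsAlt) {m n l : ℕ} (h : m + n = l) (h' : n + m = l) :
    ∃ (α : Equiv.Perm (Fin (n + 2))) (β : Equiv.Perm (Fin (m + 2)))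
      (π : Equiv.Perm (Fin (l + 2))),
      α 0 = Fin.last (n + 1) ∧ π 0 = Fin.last (l + 1) ∧
      ∀ (x : P m ⊗[k] (⨂[k] _ : Fin (m + 2), E)) (y : P n ⊗[k] (⨂[k] _ : Fin (n + 2), E)),
        𝒪.glueT ω h' (𝒪.decorated E n α y) (𝒪.decorated E m β x)
          = -𝒪.decorated E l π (𝒪.glueT ω h x y) := by
  -- The interchange with the factors exchanged, read backwards: its permutations are replaced by
  -- their inverses.
  obtain ⟨α, β, π, -, hβ, hπ, H⟩ := 𝒪.exists_glueT_swap (E := E) ω hω h' h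
  refine ⟨β⁻¹, α⁻¹, π⁻¹, by simp [← hβ], by simp [← hπ], fun x y => ?_⟩
  have := H (𝒪.decorated E n β⁻¹ y) (𝒪.decorated E m α⁻¹ x)
  rw [← decorated_mul_apply, ← decorated_mul_apply, mul_inv_cancel, mul_inv_cancel, map_one,
    map_one, Module.End.one_apply, Module.End.one_apply] at this
  rw [this, map_neg, neg_neg, ← decorated_mul_apply, inv_mul_cancel, map_one,
    Module.End.one_apply]

theorem toR_glueT_swap (hω : ω.IsAlt) {m n l : ℕ} (h : m + n = l) (h' : n + m = l)
    (x : P m ⊗[k] (⨂[k] _ : Fin (m + 2), E)) (y : P n ⊗[k] (⨂[k] _ : Fin (n + 2), E))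
    (hx : ∀ σ, 𝒪.decorated E m σ x = x) (hy : ∀ σ, 𝒪.decorated E n σ y = y) :
    𝒪.toR l (𝒪.glueT ω h x y) = -𝒪.toR l (𝒪.glueT ω h' y x) := by
  obtain ⟨α, β, π, -, -, -, H⟩ := 𝒪.exists_glueT_swap (E := E) ω hω h h'
  have := H x y
  rw [hx, hy] at this
  rw [this, map_neg, toR_decorated, neg_neg]

/-- Reversal of a chain of three glued invariant elements. -/
theorem toR_glueT_reverse (hω : ω.IsAlt) {m n r nr mn s : ℕ} (h₁ : n + r = nr) (h₂ : m + nr = s)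
    (h₃ : n + m = mn) (h₄ : r + mn = s)
    (x : P m ⊗[k] (⨂[k] _ : Fin (m + 2), E)) (y : P n ⊗[k] (⨂[k] _ : Fin (n + 2), E))
    (z : P r ⊗[k] (⨂[k] _ : Fin (r + 2), E)) (hx : ∀ σ, 𝒪.decorated E m σ x = x)
    (hy : ∀ σ, 𝒪.decorated E n σ y = y) (hz : ∀ σ, 𝒪.decorated E r σ z = z) :
    𝒪.toR s (𝒪.glueT ω h₂ x (𝒪.glueT ω h₁ y z)) = 𝒪.toR s (𝒪.glueT ω h₄ z (𝒪.glueT ω h₃ y x)) := by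
  have h₁' : r + n = nr := by omega
  have h₂' : nr + m = s := by omega
  obtain ⟨α, β, π, hα, -, H⟩ := 𝒪.exists_glueT_swap_last (E := E) ω hω h₂ h₂'
  obtain ⟨α', β', π', -, hπ', H'⟩ := 𝒪.exists_glueT_swap_last (E := E) ω hω h₁ h₁'
  have e1 := H x (𝒪.glueT ω h₁ y z)
  have e2 := H' y z
  rw [hx] at e1
  rw [hy, hz] at e2
  -- The product y·z is not invariant, so α cannot simply be dropped. But α and π' both bring label
  -- 0 to the last place, so π' may replace it, and π'(y·z) = -z·y.
  rw [← 𝒪.toR_decorated s π, ← neg_neg (𝒪.decorated E s π _), ← e1, map_neg,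
    𝒪.toR_glueT_left ω h₂' α π' (by
      rw [Equiv.Perm.inv_eq_iff_eq.2 hα.symm, Equiv.Perm.inv_eq_iff_eq.2 hπ'.symm]),
    ← neg_neg (𝒪.decorated E nr π' _), ← e2, map_neg, LinearMap.neg_apply, map_neg, neg_neg,
    𝒪.glueT_assoc ω h₁' h₂' h₃ h₄]

/-- The bracket of `x` with `y z`, for invariant `x`, `y`, `z`. -/
theorem toR_glueT_sym_glueT [CharZero k] (hω : ω.IsAlt) {m n r nr s : ℕ} (h₁ : n + r = nr)
    (h₁' : r + n = nr) (h₂ : m + nr = s)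
    (x : P m ⊗[k] (⨂[k] _ : Fin (m + 2), E)) (y : P n ⊗[k] (⨂[k] _ : Fin (n + 2), E))
    (z : P r ⊗[k] (⨂[k] _ : Fin (r + 2), E))
    (hy : ∀ σ, 𝒪.decorated E n σ y = y) (hz : ∀ σ, 𝒪.decorated E r σ z = z) :
    𝒪.toR s (𝒪.glueT ω h₂ x (𝒪.sym nr (𝒪.glueT ω h₁ y z)))
      = (n + 1) • 𝒪.toR s (𝒪.glueT ω h₂ x (𝒪.glueT ω h₁ y z))
        - (r + 1) • 𝒪.toR s (𝒪.glueT ω h₂ x (𝒪.glueT ω h₁' z y)) := by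
  have hb : Function.Bijective fun b : Fin (nr + 2) => (Equiv.swap b 0)⁻¹ 0 := by
    simp [← Function.id_def]
  rw [𝒪.toR_glueT_sym_right ω h₂ _ hb]
  -- The labels of y·z are those of y except the last and those of z except 0.
  let e : Fin (n + 1) ⊕ Fin (r + 1) ≃ Fin (nr + 2) :=
    finSumFinEquiv.trans (finCongr (by omega))
  rw [← e.sum_comp, Fintype.sum_sum_type, sub_eq_add_neg]
  congr 1
  · rw [Finset.sum_congr rfl (g := fun _ => 𝒪.toR s (𝒪.glueT ω h₂ x (𝒪.glueT ω h₁ y z)))]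
    · simp
    intro a _
    obtain ⟨π, hπ, H⟩ := 𝒪.exists_glueT_left (E := E) ω h₁ (Equiv.swap a.castSucc 0) (by
      apply Equiv.swap_apply_of_ne_of_ne
      · exact (Fin.castSucc_lt_last a).ne'
      · exact (Fin.last_pos).ne')
    have hπa : π (e (Sum.inl a)) = 0 := by
      have : e (Sum.inl a) = Fin.castLE (by omega) a.castSucc := by
        ext
        simp [e]
      rw [this, hπ]
      simp
    have := H y z
    rw [hy] at this
    -- Invariance of y makes y·z fixed by π, which brings the chosen label of y to place 0.
    nth_rw 2 [this]
    apply toR_glueT_right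
    rw [Equiv.Perm.inv_eq_iff_eq.2 hπa.symm]
    simp
  · rw [Finset.sum_congr rfl (g := fun _ => -𝒪.toR s (𝒪.glueT ω h₂ x (𝒪.glueT ω h₁' z y)))]
    · simp
    intro c _
    obtain ⟨π, hπ, H⟩ := 𝒪.exists_glueT_right (E := E) ω h₁ (Equiv.swap c.succ (Fin.last (r + 1)))
      (by
        apply Equiv.swap_apply_of_ne_of_ne
        · exact (Fin.succ_ne_zero c).symm
        · exact (Fin.last_pos).ne)
    -- A label of z can only be moved to the last place of y·z; the interchange θ takes it on to
    -- place 0, at the cost of a sign.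
    obtain ⟨α, β, θ, -, -, hθ, H'⟩ := 𝒪.exists_glueT_swap (E := E) ω hω h₁ h₁'
    have hπc : (θ * π) (e (Sum.inr c)) = 0 := by
      have : e (Sum.inr c) = ⟨n + c.succ, by omega⟩ := by
        ext
        simp [e]
        omega
      rw [Equiv.Perm.mul_apply, this, hπ, ← hθ]
      congr 1
      ext
      simp
      omega
    have e1 := H y z
    have e2 := H' y z
    rw [hz] at e1
    rw [hy, hz, e1, ← decorated_mul_apply] at e2
    rw [e2, map_neg, map_neg, neg_neg]
    apply toR_glueT_right
    rw [Equiv.Perm.inv_eq_iff_eq.2 hπc.symm]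
    simp

/-! ### Lie algebra axioms and the grading -/

theorem R_induction {C : 𝒪.R E → Prop} (zero : C 0) (add : ∀ x y, C x → C y → C (x + y))
    (toR : ∀ m x, C (𝒪.toR m x)) (x : 𝒪.R E) : C x := by
  induction x using DirectSum.induction_on with
  | zero => exact zero
  | add x y hx hy => exact add x y hx hy
  | of m x =>
    obtain ⟨x, rfl⟩ := Representation.Coinvariants.mk_surjective _ x
    exact toR m x

theorem bracket_skew (hω : ω.IsAlt) (x y : 𝒪.R E) : 𝒪.bracket ω x y = -𝒪.bracket ω y x := by
  induction x using 𝒪.R_induction with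
  | zero => simp
  | add x x' hx hx' => simp only [map_add, LinearMap.add_apply, hx, hx', neg_add]
  | toR m x =>
  induction y using 𝒪.R_induction with
  | zero => simp
  | add y y' hy hy' => simp only [map_add, LinearMap.add_apply, hy, hy', neg_add]
  | toR n y =>
  rw [𝒪.bracket_toR ω rfl, 𝒪.bracket_toR ω (Nat.add_comm n m)]
  exact 𝒪.toR_glueT_swap ω hω _ _ _ _ (fun σ => 𝒪.decorated_sym m σ x)
    (fun σ => 𝒪.decorated_sym n σ y)

theorem bracket_self [CharZero k] (hω : ω.IsAlt) (x : 𝒪.R E) : 𝒪.bracket ω x x = 0 := by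
  have h : (2 : k) • 𝒪.bracket ω x x = 0 := by
    rw [two_smul, add_eq_zero_iff_eq_neg]
    exact 𝒪.bracket_skew ω hω x x
  exact (smul_eq_zero_iff_right two_ne_zero).1 h

theorem bracket_bracket_toR [CharZero k] (hω : ω.IsAlt) {m n r nr s : ℕ} (h₁ : n + r = nr)
    (h₁' : r + n = nr) (h₂ : m + nr = s)
    (x : P m ⊗[k] (⨂[k] _ : Fin (m + 2), E)) (y : P n ⊗[k] (⨂[k] _ : Fin (n + 2), E))
    (z : P r ⊗[k] (⨂[k] _ : Fin (r + 2), E)) :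
    𝒪.bracket ω (𝒪.toR m x) (𝒪.bracket ω (𝒪.toR n y) (𝒪.toR r z))
      = (n + 1) • 𝒪.toR s (𝒪.glueT ω h₂ (𝒪.sym m x) (𝒪.glueT ω h₁ (𝒪.sym n y) (𝒪.sym r z)))
        - (r + 1) •
          𝒪.toR s (𝒪.glueT ω h₂ (𝒪.sym m x) (𝒪.glueT ω h₁' (𝒪.sym r z) (𝒪.sym n y))) := by
  rw [𝒪.bracket_toR ω h₁, 𝒪.bracket_toR ω h₂]
  exact 𝒪.toR_glueT_sym_glueT ω hω h₁ h₁' h₂ _ _ _ (fun σ => 𝒪.decorated_sym n σ y)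
    (fun σ => 𝒪.decorated_sym r σ z)

theorem bracket_jacobi [CharZero k] (hω : ω.IsAlt) (x y z : 𝒪.R E) :
    𝒪.bracket ω x (𝒪.bracket ω y z) + 𝒪.bracket ω y (𝒪.bracket ω z x)
      + 𝒪.bracket ω z (𝒪.bracket ω x y) = 0 := by
  induction x using 𝒪.R_induction with
  | zero => simp
  | add x x' hx hx' =>
    simp only [map_add, LinearMap.add_apply]
    -- The zero on the right is rewritten as the sum of the two Jacobi expressions known to vanish.
    rw [← add_zero (0 : 𝒪.R E)]
    nth_rw 1 [← hx]
    rw [← hx']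
    abel
  | toR m x =>
  induction y using 𝒪.R_induction with
  | zero => simp
  | add x x' hx hx' =>
    simp only [map_add, LinearMap.add_apply]
    rw [← add_zero (0 : 𝒪.R E)]
    nth_rw 1 [← hx]
    rw [← hx']
    abel
  | toR n y =>
  induction z using 𝒪.R_induction with
  | zero => simp
  | add x x' hx hx' =>
    simp only [map_add, LinearMap.add_apply]
    rw [← add_zero (0 : 𝒪.R E)]
    nth_rw 1 [← hx]
    rw [← hx']
    abel
  | toR r z =>
  have hx := fun σ => 𝒪.decorated_sym m σ x
  have hy := fun σ => 𝒪.decorated_sym n σ y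
  have hz := fun σ => 𝒪.decorated_sym r σ z
  have a₁ : n + r = n + r := rfl
  have a₂ : r + n = n + r := Nat.add_comm r n
  have b₁ : r + m = r + m := rfl
  have b₂ : m + r = r + m := Nat.add_comm m r
  have c₁ : m + n = m + n := rfl
  have c₂ : n + m = m + n := Nat.add_comm n m
  have d₁ : m + (n + r) = m + (n + r) := rfl
  have d₂ : n + (r + m) = m + (n + r) := by omega
  have d₃ : r + (m + n) = m + (n + r) := by omega
  -- The six terms pair off under xyz = zyx, yzx = xzy and yxz = zxy, with opposite coefficients
  -- ±(n+1), ±(r+1), ±(m+1).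
  rw [𝒪.bracket_bracket_toR ω hω a₁ a₂ d₁, 𝒪.bracket_bracket_toR ω hω b₁ b₂ d₂,
    𝒪.bracket_bracket_toR ω hω c₁ c₂ d₃, 𝒪.toR_glueT_reverse ω hω a₁ d₁ c₂ d₃ _ _ _ hx hy hz,
    𝒪.toR_glueT_reverse ω hω b₁ d₂ a₂ d₁ _ _ _ hy hz hx,
    𝒪.toR_glueT_reverse ω hω b₂ d₂ c₁ d₃ _ _ _ hy hx hz]
  abel

theorem grading_isInternal : DirectSum.IsInternal (𝒪.grading E) := by
  have hinj : ∀ m, Function.Injective (DirectSum.lof k ℕ (𝒪.RComp E) m) :=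
    fun m => DirectSum.of_injective m
  let e : 𝒪.R E ≃ₗ[k] ⨁ m, 𝒪.grading E m :=
    DFinsupp.mapRange.linearEquiv fun m => LinearEquiv.ofInjective _ (hinj m)
  have h : DirectSum.coeLinearMap (𝒪.grading E) ∘ₗ e.toLinearMap = LinearMap.id := by
    refine DirectSum.linearMap_ext _ fun m => LinearMap.ext fun x => ?_
    have : e (DirectSum.lof k ℕ (𝒪.RComp E) m x)
        = DirectSum.lof k ℕ (fun m => 𝒪.grading E m) m (LinearEquiv.ofInjective _ (hinj m) x) :=
      DFinsupp.mapRange_single (hf := fun m => map_zero _)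
    simp only [LinearMap.comp_apply, LinearEquiv.coe_coe, this, LinearMap.id_apply]
    exact DirectSum.coeLinearMap_lof (𝒪.grading E) m _
  have h' : ⇑(DirectSum.coeLinearMap (𝒪.grading E)) = e.symm := by
    funext y
    obtain ⟨x, rfl⟩ := e.surjective y
    simpa using LinearMap.congr_fun h x
  change Function.Bijective (DirectSum.coeLinearMap (𝒪.grading E))
  rw [h']
  exact e.symm.bijective

theorem bracket_mem_grading {m n : ℕ} {x y : 𝒪.R E} (hx : x ∈ 𝒪.grading E m)
    (hy : y ∈ 𝒪.grading E n) : 𝒪.bracket ω x y ∈ 𝒪.grading E (m + n) := by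
  obtain ⟨x, rfl⟩ := hx
  obtain ⟨y, rfl⟩ := hy
  rw [bracket_lof]
  exact LinearMap.mem_range_self _ _

end CyclicOperadStr
end

theorem mainTheorem8 {k : Type u} [Field k] [CharZero k]
    {P : ℕ → Type v} [∀ m, AddCommGroup (P m)] [∀ m, Module k (P m)]
    (𝒪 : CyclicOperadStr k P)
    {E : Type w} [AddCommGroup E] [Module k E] [FiniteDimensional k E]
    (ω : E →ₗ[k] E →ₗ[k] k) (hω : ω.IsAlt) (hω' : ω.Nondegenerate) :
    (∀ (m n : ℕ) (x : P m ⊗[k] (⨂[k] _ : Fin (m + 2), E))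
        (y : P n ⊗[k] (⨂[k] _ : Fin (n + 2), E)),
      𝒪.bracket ω
          (DirectSum.lof k ℕ (𝒪.RComp E) m (Representation.Coinvariants.mk (𝒪.decorated E m) x))
          (DirectSum.lof k ℕ (𝒪.RComp E) n (Representation.Coinvariants.mk (𝒪.decorated E n) y))
        = DirectSum.lof k ℕ (𝒪.RComp E) (m + n)
            (∑ a : Fin (m + 2), ∑ b : Fin (n + 2),
              𝒪.glue ω m n (𝒪.decorated E m (finRotate (m + 2) ^ (a : ℕ)) x)
                (𝒪.decorated E n (finRotate (n + 2) ^ (b : ℕ)) y))) ∧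
    IsGradedLieAlgebra (𝒪.grading E) (𝒪.bracket ω) := by

  refine ⟨fun m n x y => ?_, 𝒪.grading_isInternal, 𝒪.bracket_mem_grading ω, 𝒪.bracket_self ω hω,
    𝒪.bracket_jacobi ω hω⟩
  refine (𝒪.bracket_toR_eq_sum_rotations ω rfl x y).trans ?_
  simp only [map_sum]
  rfl
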